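/- Conventions. $\mathsf{Mon}_0$ is the category of commutative monoids with an absorbing element $0$, and $-\otimes_{\mathbb F_1}\mathbb Z:\mathsf{Mon}_0\to\mathsf{Ring}$ is the left adjoint of the forgetful functor $|{-}|$ (the monoid ring modulo the class of $0$). An *nblueprint* is a pair $(A,\ A\otimes_{\mathbb F_1}\mathbb Z\to R)$ with $A\in\mathsf{Mon}_0$ and $A\otimes_{\mathbb F_1}\mathbb Z\to R$ a surjective ring homomorphism; it is a *blueprint* if moreover $A\to|R|$ is injective. Schemes relative to $\mathsf{Mon}_0$ (*monoidal schemes*) and relative to nblueprints are understood in the sense of Toën–Vaquié: Zariski sheaves of sets on the category of affine schemes that admit an affine Zariski cover, where open Zariski immersions of affine schemes are the flat epimorphisms of finite presentation. A *$\widetilde{\mathsf B}$-scheme* is a scheme relative to nblueprints that admits a Zariski cover by spectra of blueprints. The functor $\rho(A,A\otimes_{\mathbb F_1}\mathbb Z\to R)=A$ induces the functor $T\mapsto T\circ\rho$ on sheaves, and its left adjoint sends a $\widetilde{\mathsf B}$-scheme $\Sigma$ to its underlying monoidal scheme $\underline\Sigma$. An *$\mathbb F_1$-scheme with relations* consists of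 a $\widetilde{\mathsf B}$-scheme $\Sigma$, a classical scheme $\Sigma'_{\mathbb Z}$, and a natural transformation $\Phi:\underline\Sigma\to\Sigma'_{\mathbb Z}\circ(-\otimes_{\mathbb F_1}\mathbb Z)$ such that the induced map $\underline\Sigma(|K|)\to\Sigma'_{\mathbb Z}(K)$ is bijective for every field $K$. Let $x$ be a point of the geometric realization of $\underline\Sigma$, let $\mathcal O_{\underline\Sigma,x}$ be the stalk (a monoid), $\mathcal O_{\underline\Sigma,x}^\times$ its group of units, and $G$ an abelian group. Each $f\in\operatorname{Hom}(\mathcal O_{\underline\Sigma,x}^\times,G)$ extends by $0$ on non-units to $\mathcal O_{\underline\Sigma,x}\to G\cup\{0\}$, and so gives a $(G\cup\{0\})$-point of $\underline\Sigma$ over $x$. Let $\operatorname{Hom}_{\mathsf B}(\mathcal O_{\Sigma,x}^\times,G)\subseteq\operatorname{Hom}(\mathcal O_{\underline\Sigma,x}^\times,G)$ be the subset of those $f$ for which this point lifts to a point of $\Sigma$ with values in the nblueprint $(G\cup\{0\},\ (G\cup\{0\})\otimes_{\mathbb F_1}\mathbb Z=(G\cup\{0\})\otimes_{\mathbb F_1}\mathbb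 Z)$; for $\Sigma=\operatorname{Spec}(A,A\otimes_{\mathbb F_1}\mathbb Z\to R)$ this says that $A\otimes_{\mathbb F_1}\mathbb Z\to(G\cup\{0\})\otimes_{\mathbb F_1}\mathbb Z$ factors through $R$. $\Sigma$ is *noetherian* if $\underline\Sigma$ has a finite affine Zariski cover by spectra of noetherian monoids (monoids whose congruences satisfy the ascending chain condition). A noetherian $\Sigma$ is *torsion-free* if for every point $x$ there is a polynomial $p_x$ with $\#\operatorname{Hom}_{\mathsf B}(\mathcal O_{\Sigma,x}^\times,G)=p_x(\#G)$ for every finite abelian group $G$. For $n\ge1$ let $\mathbb F_{1^n}$ be the cyclic group of order $n$ with an absorbing element adjoined, and put $$P(\underline\Sigma,n)=\sum_{x}\#\operatorname{Hom}(\mathcal O_{\underline\Sigma,x}^\times,\mathbb F_{1^n}),\qquad Q(\underline\Sigma,n)=\sum_{x}\#\operatorname{Hom}_{\mathsf B}(\mathcal O_{\Sigma,x}^\times,\mathbb F_{1^n}),$$ where $x$ runs over the points of the geometric realization of $\underline\Sigma$ and the values are taken in $\mathbb N\cup\{\infty\}$. **Proposition.** Let $\Sigma$ be the $\widetilde{\mathsf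 B}$-scheme underlying an $\mathbb F_1$-scheme with relations, and suppose that $\Sigma$ is noetherian and torsion-free. Then the geometric realization of $\underline\Sigma$ has finitely many points, $Q(\underline\Sigma,n)$ is finite and polynomial in $n\ge 1$, and $$Q(\underline\Sigma,n)\le P(\underline\Sigma,n)\qquad\text{for all } n\ge 1 .$$ -/

import Mathlib

open CategoryTheory Opposite

universe u

noncomputable section

namespace F1Geom

/-! ## Relative algebraic geometry

The constructions below use a category `M` of commutative monoid objects and, for every `V : M`, the
category of `V`-modules, with the forgetful functors along the morphisms of `M`. They are applied to
exactly two instances, both constructed below: commutative monoids with an absorbing element, and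
blueprints with ring relations. -/

/-- The module categories of the monoid objects in `M`, and the forgetful functors between them. -/
class HasModules (M : Type (u + 1)) [Category.{u} M] where
  /-- `V`-modules -/
  Mod : M → Type (u + 1)
  cat : ∀ V, Category.{u} (Mod V)
  /-- the forgetful functor from `W`-modules to `V`-modules -/
  res : ∀ {V W : M}, (V ⟶ W) → (Mod W ⥤ Mod V)

attribute [instance] HasModules.cat

section Relative

variable {M : Type (u + 1)} [Category.{u} M]

/-- Presheaves of sets on the category `Mᵒᵖ` of affine schemes. -/
abbrev PSh (M : Type (u + 1)) [Category.{u} M] := (Mᵒᵖ)ᵒᵖ ⥤ Type u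

/-- The presheaf represented by `Spec V`. -/
abbrev Spec (V : M) : PSh M := yoneda.obj (op V)

/-- The set of `V`-points of a presheaf. -/
abbrev Pts (F : PSh M) (V : M) : Type u := F.obj (op (op V))

/-- The map on points induced by a morphism `V ⟶ W`. -/
abbrev ptsMap (F : PSh M) {V W : M} (f : V ⟶ W) : Pts F V → Pts F W := fun x => F.map f.op.op x

variable [HasModules M]

/-- `Spec W ⟶ Spec V` is flat: the base change functor from `V`-modules to `W`-modules (the left
adjoint of the forgetful functor) is exact. -/
def IsFlat {V W : M} (f : V ⟶ W) : Prop :=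
  ∃ L : HasModules.Mod V ⥤ HasModules.Mod W,
    Nonempty (L ⊣ HasModules.res f) ∧ Limits.PreservesFiniteLimits L

/-- `Spec W ⟶ Spec V` is an open Zariski immersion of affine schemes: a flat epimorphism of finite
presentation. The last two notions are expressed on the side of `M`. -/
def IsAffineOpenImmersion {V W : M} (f : V ⟶ W) : Prop :=
  IsFlat f ∧ Epi f ∧ IsFinitelyPresentable.{u} (Under.mk f)

/-- Zariski covers of an affine scheme: families of open Zariski immersions with a finite subfamily
whose base change functors are jointly conservative. -/
def zariskiCovers (M : Type (u + 1)) [Category.{u} M] [HasModules M] : Precoverage Mᵒᵖ where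
  coverings X := { S : Presieve X |
    (∀ ⦃Y : Mᵒᵖ⦄ (f : Y ⟶ X), S f → IsAffineOpenImmersion f.unop) ∧
    ∃ T : Set (Σ Y : Mᵒᵖ, (Y ⟶ X)), T.Finite ∧ (∀ f ∈ T, S f.2) ∧
      ∀ ⦃N N' : HasModules.Mod X.unop⦄ (g : N ⟶ N'),
        (∀ f ∈ T, ∀ L : HasModules.Mod X.unop ⥤ HasModules.Mod f.1.unop,
          (L ⊣ HasModules.res f.2.unop) → IsIso (L.map g)) → IsIso g }

/-- The Zariski topology on the category of affine schemes. -/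
def zariski (M : Type (u + 1)) [Category.{u} M] [HasModules M] : GrothendieckTopology Mᵒᵖ :=
  (zariskiCovers M).toGrothendieck

/-- Zariski sheaves. -/
def IsZariskiSheaf (F : PSh M) : Prop := Presieve.IsSheaf (zariski M) F

/-- Zariski opens of an affine scheme: images, in the category of sheaves, of a coproduct of open
Zariski immersions of affine schemes. -/
def IsZariskiOpen {V : M} (U : Subfunctor (Spec V)) : Prop :=
  ∃ (ι : Type u) (W : ι → M) (f : ∀ i, V ⟶ W i), (∀ i, IsAffineOpenImmersion (f i)) ∧
    U = (⨆ i, Subfunctor.range (yoneda.map (f i).op)).sheafify (zariski M)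

/-- Open subfunctors: the preimage in any affine scheme is a Zariski open. -/
def IsOpenSub {F : PSh M} (U : Subfunctor F) : Prop :=
  ∀ (V : M) (g : Spec V ⟶ F), IsZariskiOpen (U.preimage g)

/-- Open Zariski immersions of sheaves: for all `Spec V ⟶ G`, the projection from the fibre product
`F ×_G Spec V` to `Spec V` is a monomorphism whose image is a Zariski open. -/
def IsOpenImmersion {F G : PSh M} (p : F ⟶ G) : Prop :=
  Mono p ∧ IsOpenSub (Subfunctor.range p)

/-- `(Spec (V i) ⟶ F)` is an affine Zariski cover: open Zariski immersions such that the induced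
morphism from the coproduct is an epimorphism of sheaves. -/
def IsAffineZariskiCover {F : PSh M} {ι : Type u} {V : ι → M} (p : ∀ i, Spec (V i) ⟶ F) : Prop :=
  (∀ i, IsOpenImmersion (p i)) ∧ (⨆ i, Subfunctor.range (p i)).sheafify (zariski M) = ⊤

/-- Schemes relative to `M`: sheaves which admit an affine Zariski cover, here by affine schemes
`Spec V` such that `V` satisfies `P`. -/
def IsSchemeCoveredBy (P : M → Prop) (F : PSh M) : Prop :=
  IsZariskiSheaf F ∧ ∃ (ι : Type u) (V : ι → M) (p : ∀ i, Spec (V i) ⟶ F),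
    (∀ i, P (V i)) ∧ IsAffineZariskiCover p

end Relative

/-! ## Commutative monoids with absorbing element, and their modules -/

/-- Commutative monoids with an absorbing element `0`. -/
structure Mon0 : Type (u + 1) where
  carrier : Type u
  [str : CommMonoidWithZero carrier]

attribute [instance] Mon0.str

instance : CoeSort Mon0.{u} (Type u) := ⟨Mon0.carrier⟩

instance : Category.{u} Mon0.{u} where
  Hom A B := A →*₀ B
  id A := MonoidWithZeroHom.id A
  comp f g := MonoidWithZeroHom.comp g f

/-- The homomorphism underlying a morphism of `Mon0`. -/
abbrev Mon0.fn {A B : Mon0.{u}} (f : A ⟶ B) : A →*₀ B := f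

/-- A morphism of `Mon0` from a homomorphism. -/
abbrev Mon0.ofHom {A B : Mon0.{u}} (f : A →*₀ B) : A ⟶ B := f

/-- The forgetful functor to sets. -/
def Mon0.forget : Mon0.{u} ⥤ Type u where
  obj A := A
  map f := ↾(fun a => Mon0.fn f a)

/-- Modules over `A` in pointed sets: pointed sets with an action of the monoid with zero `A`. -/
structure PtMod (A : Mon0.{u}) : Type (u + 1) where
  carrier : Type u
  [zero : Zero carrier]
  [act : MulActionWithZero A carrier]

attribute [instance] PtMod.zero PtMod.act

/-- Equivariant maps. (They preserve the base point `0 = 0 • 0`.) -/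
instance (A : Mon0.{u}) : Category.{u} (PtMod A) where
  Hom N N' := N.carrier →[A] N'.carrier
  id N := MulActionHom.id A
  comp f g := MulActionHom.comp g f

/-- The equivariant map underlying a morphism. -/
abbrev PtMod.fn {A : Mon0.{u}} {N N' : PtMod A} (h : N ⟶ N') : N.carrier →[A] N'.carrier := h

/-- Restriction of the action along a morphism of monoids. -/
def PtMod.res {A B : Mon0.{u}} (f : A ⟶ B) : PtMod B ⥤ PtMod A where
  obj N :=
    letI := MulActionWithZero.compHom N.carrier (Mon0.fn f)
    ⟨N.carrier⟩
  map {N N'} h :=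
    letI := MulActionWithZero.compHom N.carrier (Mon0.fn f)
    letI := MulActionWithZero.compHom N'.carrier (Mon0.fn f)
    (⟨fun n => PtMod.fn h n, fun a n => map_smul (PtMod.fn h) (Mon0.fn f a) n⟩ :
      N.carrier →[A] N'.carrier)

instance : HasModules Mon0.{u} where
  Mod := PtMod
  cat := inferInstance
  res := PtMod.res

/-- A monoidal scheme: a scheme relative to pointed sets. -/
def IsMonoidalScheme (X : PSh Mon0.{u}) : Prop := IsSchemeCoveredBy (fun _ => True) X

/-- A commutative monoid is noetherian if its congruences satisfy the ascending chain condition. -/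
def IsNoetherianMonoid (A : Mon0.{u}) : Prop := WellFoundedGT (Con A)

/-- A monoidal scheme is noetherian if it has a finite affine Zariski cover by spectra of noetherian
monoids. -/
def IsNoetherianMonoidalScheme (X : PSh Mon0.{u}) : Prop :=
  IsMonoidalScheme X ∧ ∃ (ι : Type u) (_ : Finite ι) (A : ι → Mon0.{u}) (p : ∀ i, Spec (A i) ⟶ X),
    (∀ i, IsNoetherianMonoid (A i)) ∧ IsAffineZariskiCover p

/-! ## The functor `- ⊗ ℤ` from monoids with zero to rings -/

/-- The ring `A ⊗ ℤ`: the monoid ring of `A` modulo the class of the absorbing element. -/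
abbrev TensorZ (A : Type u) [CommMonoidWithZero A] : Type u :=
  MonoidAlgebra ℤ A ⧸ Ideal.span {(MonoidAlgebra.single (0 : A) (1 : ℤ) : MonoidAlgebra ℤ A)}

/-- The unit `A → |A ⊗ ℤ|` of the adjunction. -/
def TensorZ.unit (A : Type u) [CommMonoidWithZero A] : A →*₀ TensorZ A where
  toFun a := Ideal.Quotient.mk _ (MonoidAlgebra.of ℤ A a)
  map_zero' := Ideal.Quotient.eq_zero_iff_mem.2 (Ideal.subset_span (by simp [MonoidAlgebra.of]))
  map_one' := by rw [map_one, map_one]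
  map_mul' a b := by rw [map_mul, map_mul]

/-- The ring homomorphism `A ⊗ ℤ → R` adjoint to `A → |R|`. -/
def TensorZ.lift {A : Type u} [CommMonoidWithZero A] {R : Type u} [CommRing R] (f : A →*₀ R) :
    TensorZ A →+* R :=
  Ideal.Quotient.lift _ (MonoidAlgebra.lift ℤ R A (f : A →* R)).toRingHom (by
    intro x hx
    refine (Ideal.span_le (I := RingHom.ker _)).2 ?_ hx
    intro y hy
    rw [Set.mem_singleton_iff] at hy
    subst hy
    simp [RingHom.mem_ker])

@[simp] theorem TensorZ.lift_unit {A : Type u} [CommMonoidWithZero A] {R : Type u} [CommRing R]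
    (f : A →*₀ R) (a : A) : TensorZ.lift f (TensorZ.unit A a) = f a := by
  simp [TensorZ.lift, TensorZ.unit]

theorem TensorZ.hom_ext {A : Type u} [CommMonoidWithZero A] {R : Type u} [CommRing R]
    {f g : TensorZ A →+* R} (h : ∀ a, f (TensorZ.unit A a) = g (TensorZ.unit A a)) : f = g := by
  apply Ideal.Quotient.ringHom_ext
  apply MonoidAlgebra.ringHom_ext
  · intro r
    have h1 : (MonoidAlgebra.single (1 : A) r : MonoidAlgebra ℤ A) = (r : MonoidAlgebra ℤ A) := by
      simp [MonoidAlgebra.intCast_def]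
    simp [h1]
  · intro a
    exact h a

/-- The functor `- ⊗ ℤ`, left adjoint to the forgetful functor from rings to monoids with zero. -/
def tensorZ : Mon0.{u} ⥤ CommRingCat.{u} where
  obj A := CommRingCat.of (TensorZ A)
  map {A B} f := CommRingCat.ofHom (TensorZ.lift ((TensorZ.unit B).comp (Mon0.fn f)))
  map_id A := by
    apply CommRingCat.hom_ext
    exact TensorZ.hom_ext (fun a => TensorZ.lift_unit _ a)
  map_comp {A B C} f g := by
    apply CommRingCat.hom_ext
    refine TensorZ.hom_ext (A := A) (R := TensorZ C) (fun a => ?_)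
    refine (TensorZ.lift_unit ((TensorZ.unit C).comp (Mon0.fn (f ≫ g))) a).trans ?_
    refine Eq.trans ?_ (congrArg (TensorZ.lift ((TensorZ.unit C).comp (Mon0.fn g)))
      (TensorZ.lift_unit ((TensorZ.unit B).comp (Mon0.fn f)) a)).symm
    exact (TensorZ.lift_unit ((TensorZ.unit C).comp (Mon0.fn g)) (Mon0.fn f a)).symm

/-! ## Blueprints with ring relations, and their modules -/

/-- Pairs `(A, A ⊗ ℤ → R)` with `A ⊗ ℤ → R` surjective, a full subcategory of `(- ⊗ ℤ) / Ring`. -/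
abbrev NBlue : Type (u + 1) :=
  ObjectProperty.FullSubcategory
    (fun X : Comma tensorZ.{u} (𝟭 CommRingCat.{u}) => Function.Surjective X.hom.hom)

namespace NBlue

/-- The monoid `A` of `(A, A ⊗ ℤ → R)`. -/
abbrev mon (V : NBlue.{u}) : Mon0.{u} := V.obj.left

/-- The ring `R` of `(A, A ⊗ ℤ → R)`. -/
abbrev ring (V : NBlue.{u}) : CommRingCat.{u} := V.obj.right

/-- The map `A ⊗ ℤ → R`. -/
abbrev proj (V : NBlue.{u}) : TensorZ V.mon →+* V.ring := V.obj.hom.hom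

/-- The composition `A → |A ⊗ ℤ| → |R|`. -/
def incl (V : NBlue.{u}) : V.mon →*₀ V.ring :=
  (V.proj.toMonoidWithZeroHom : TensorZ V.mon →*₀ V.ring).comp (TensorZ.unit V.mon)

/-- Blueprints (with ring relations): the composition `A → |R|` is injective. -/
def IsBlueprint (V : NBlue.{u}) : Prop := Function.Injective V.incl

/-- The forgetful functor `(A, A ⊗ ℤ → R) ↦ A`. -/
def rho : NBlue.{u} ⥤ Mon0.{u} := ObjectProperty.ι _ ⋙ Comma.fst _ _

/-- The object `(A, A ⊗ ℤ = A ⊗ ℤ)`. -/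
def sigma (A : Mon0.{u}) : NBlue.{u} where
  obj := { left := A, right := tensorZ.obj A, hom := 𝟙 _ }
  property := fun x => ⟨x, rfl⟩

/-- The monoid part of a morphism. -/
abbrev monMap {V W : NBlue.{u}} (f : V ⟶ W) : V.mon →*₀ W.mon := f.hom.left

/-- The ring part of a morphism. -/
abbrev ringMap {V W : NBlue.{u}} (f : V ⟶ W) : V.ring →+* W.ring := f.hom.right.hom

theorem incl_monMap {V W : NBlue.{u}} (f : V ⟶ W) (a : V.mon) :
    W.incl (monMap f a) = ringMap f (V.incl a) := by
  have h := f.hom.w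
  have h' := congrArg (fun k => k.hom (TensorZ.unit V.mon a)) h
  refine Eq.trans (congrArg W.proj ?_) h'
  exact (TensorZ.lift_unit ((TensorZ.unit W.mon).comp (monMap f)) a).symm

/-- Modules over `(A, A ⊗ ℤ → R)`: a pointed set `N` with an action of `A`, an `R`-module `K`, and a
compatible map `N → K` whose image generates `K`. -/
structure Module (V : NBlue.{u}) : Type (u + 1) where
  set : Type u
  grp : Type u
  [setZero : Zero set]
  [act : MulActionWithZero V.mon set]
  [grpStr : AddCommGroup grp]
  [mod : _root_.Module V.ring grp]
  map : set → grp
  map_smul : ∀ (a : V.mon) (n : set), map (a • n) = V.incl a • map n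
  generates : AddSubgroup.closure (Set.range map) = ⊤

attribute [instance] Module.setZero Module.act Module.grpStr Module.mod

/-- Morphisms of modules: an `A`-equivariant and an `R`-linear map, compatible with `N → K`. -/
@[ext] structure Module.Hom {V : NBlue.{u}} (N N' : Module V) : Type u where
  onSet : N.set →[V.mon] N'.set
  onGrp : N.grp →ₗ[V.ring] N'.grp
  comm : ∀ n, onGrp (N.map n) = N'.map (onSet n)

instance (V : NBlue.{u}) : Category.{u} (Module V) where
  Hom := Module.Hom
  id N := ⟨MulActionHom.id _, LinearMap.id, fun _ => rfl⟩
  comp f g := ⟨g.onSet.comp f.onSet, g.onGrp.comp f.onGrp, fun n => by simp [f.comm, g.comm]⟩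

/-- Restriction of both actions along a morphism. -/
def Module.res {V W : NBlue.{u}} (f : V ⟶ W) : Module W ⥤ Module V where
  obj N :=
    letI := MulActionWithZero.compHom N.set (monMap f)
    letI := _root_.Module.compHom N.grp (ringMap f)
    { set := N.set
      grp := N.grp
      map := N.map
      map_smul := fun a n => by
        change N.map (monMap f a • n) = ringMap f (V.incl a) • N.map n
        rw [N.map_smul, incl_monMap]
      generates := N.generates }
  map {N N'} h :=
    letI := MulActionWithZero.compHom N.set (monMap f)
    letI := MulActionWithZero.compHom N'.set (monMap f)
    letI := _root_.Module.compHom N.grp (ringMap f)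
    letI := _root_.Module.compHom N'.grp (ringMap f)
    { onSet := ⟨fun n => Module.Hom.onSet h n,
        fun a n => _root_.map_smul (Module.Hom.onSet h) (monMap f a) n⟩
      onGrp :=
        { toFun := fun m => Module.Hom.onGrp h m
          map_add' := fun m m' => _root_.map_add (Module.Hom.onGrp h) m m'
          map_smul' := fun r m => _root_.map_smul (Module.Hom.onGrp h) (ringMap f r) m }
      comm := Module.Hom.comm h }

instance : HasModules NBlue.{u} where
  Mod := Module
  cat := inferInstance
  res := Module.res

end NBlue

/-- Schemes relative to `NBlue` which admit a Zariski cover by spectra of blueprints. -/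
def IsBlueScheme (S : PSh NBlue.{u}) : Prop := IsSchemeCoveredBy NBlue.IsBlueprint S

/-- The right adjoint on sheaves: `T ↦ T ∘ ρ`. -/
abbrev sigmaHat (T : PSh Mon0.{u}) : PSh NBlue.{u} := NBlue.rho.op.op ⋙ T

/-- `η` exhibits the sheaf `X` as the image of `S` under the left adjoint of `T ↦ T ∘ ρ`. -/
def IsUnderlying {S : PSh NBlue.{u}} {X : PSh Mon0.{u}} (η : S ⟶ sigmaHat X) : Prop :=
  IsZariskiSheaf X ∧ ∀ T : PSh Mon0.{u}, IsZariskiSheaf T → ∀ α : S ⟶ sigmaHat T,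
    ∃! β : X ⟶ T, η ≫ Functor.whiskerLeft NBlue.rho.op.op β = α

/-! ## Schemes over the field with one element, with relations -/

/-- The functor of points, on commutative rings, of a classical scheme. -/
abbrev ringPoints (Y : AlgebraicGeometry.Scheme.{u}) : PSh CommRingCat.{u} :=
  AlgebraicGeometry.Scheme.Spec.op ⋙ yoneda.obj Y

/-- The monoid with zero `|R|` underlying a ring. -/
def underlying (R : CommRingCat.{u}) : Mon0.{u} := ⟨R⟩

/-- The counit `|R| ⊗ ℤ → R`. -/
def counit (R : CommRingCat.{u}) : tensorZ.obj (underlying R) ⟶ R :=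
  CommRingCat.ofHom (TensorZ.lift (MonoidWithZeroHom.id R))

/-- The map `X(|R|) → Y(R)` induced by a transformation `Φ` from `X` to `Y ∘ (- ⊗ ℤ)`. -/
def inducedOnRing {X : PSh Mon0.{u}} {Y : AlgebraicGeometry.Scheme.{u}}
    (Φ : X ⟶ tensorZ.op.op ⋙ ringPoints Y) (R : CommRingCat.{u}) :
    Pts X (underlying R) → Pts (ringPoints Y) R :=
  fun x => ptsMap (ringPoints Y) (counit R) (Φ.app (op (op (underlying R))) x)

/-- An `𝔽₁`-scheme with relations: a scheme `blue` over blueprints together with an `𝔽₁`-scheme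
`(under, ringScheme, Φ)` whose monoidal scheme is the one underlying `blue`. -/
structure F1SchemeWithRelations : Type (u + 1) where
  blue : PSh NBlue.{u}
  isBlueScheme : IsBlueScheme blue
  under : PSh Mon0.{u}
  isMonoidalScheme : IsMonoidalScheme under
  unit : blue ⟶ sigmaHat under
  isUnderlying : IsUnderlying unit
  ringScheme : AlgebraicGeometry.Scheme.{u}
  Φ : under ⟶ tensorZ.op.op ⋙ ringPoints ringScheme
  bijective_on_fields : ∀ K : CommRingCat.{u}, IsField K → Function.Bijective (inducedOnRing Φ K)

/-! ## Geometric realization of a monoidal scheme and its stalks -/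

/-- A group with an absorbing element adjoined. -/
def adjZero (G : Type u) [CommGroup G] : Mon0.{u} := ⟨WithZero G⟩

/-- `𝔽₁ = {0, 1}`. -/
abbrev F1 : Mon0.{u} := adjZero PUnit.{u + 1}

/-- The homomorphism `G ∪ {0} → 𝔽₁` which sends `G` to `1`. -/
def toF1 (G : Type u) [CommGroup G] : adjZero G ⟶ F1.{u} :=
  Mon0.ofHom (A := adjZero G) (B := F1.{u}) (WithZero.map' (1 : G →* PUnit.{u + 1}))

/-- The set of points of the geometric realization of `X`. For `X = Spec A` these are the prime
ideals of `A`: a homomorphism `A → {0, 1}` corresponds to the prime ideal of elements sent to `0`. -/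
abbrev Point (X : PSh Mon0.{u}) : Type u := Pts X F1

/-- The affine line, whose `A`-points are the elements of `A`. Morphisms from a subfunctor `U` to it
are the functions on `U`. -/
abbrev affineLine : PSh Mon0.{u} := unopUnop Mon0.{u} ⋙ Mon0.forget

section Stalk

variable {X : PSh Mon0.{u}}

/-- Functions on a subfunctor. -/
abbrev Func (U : Subfunctor X) : Type (u + 1) := U.toFunctor ⟶ affineLine

/-- The value of a function on `U` at an `A`-point of `U`. -/
def Func.val {U : Subfunctor X} (φ : Func U) {A : Mon0.{u}} (s : Pts X A)
    (hs : s ∈ U.obj (op (op A))) : A :=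
  φ.app (op (op A)) ⟨s, hs⟩

theorem Func.ext' {U : Subfunctor X} {φ ψ : Func U}
    (h : ∀ (A : Mon0.{u}) (s : Pts X A) (hs : s ∈ U.obj (op (op A))), φ.val s hs = ψ.val s hs) :
    φ = ψ := by
  apply NatTrans.ext
  funext A
  apply ConcreteCategory.hom_ext
  rintro ⟨s, hs⟩
  exact h A.unop.unop s hs

theorem Func.val_map {U : Subfunctor X} (φ : Func U) {A B : Mon0.{u}} (f : A ⟶ B) (s : Pts X A)
    (hs : s ∈ U.obj (op (op A))) :
    φ.val (ptsMap X f s) (U.map f.op.op hs) = Mon0.fn f (φ.val s hs) :=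
  congrArg (fun k => k ⟨s, hs⟩) (φ.naturality f.op.op)

/-- Functions from natural families of maps. -/
def Func.mk {U : Subfunctor X} (v : ∀ (A : Mon0.{u}) (s : Pts X A), s ∈ U.obj (op (op A)) → A)
    (nat : ∀ {A B : Mon0.{u}} (f : A ⟶ B) (s : Pts X A) (hs : s ∈ U.obj (op (op A))),
      v B (ptsMap X f s) (U.map f.op.op hs) = Mon0.fn f (v A s hs)) : Func U where
  app A := ↾(fun s => v A.unop.unop s.1 s.2)
  naturality A B f := by
    apply ConcreteCategory.hom_ext
    rintro ⟨s, hs⟩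
    exact nat f.unop.unop s hs

/-- Pointwise multiplication of functions. -/
instance (U : Subfunctor X) : CommMonoidWithZero (Func U) where
  mul φ ψ := Func.mk (fun _ s hs => φ.val s hs * ψ.val s hs)
    (fun f s hs => by rw [φ.val_map, ψ.val_map, map_mul])
  one := Func.mk (fun _ _ _ => 1) (fun f _ _ => (map_one (Mon0.fn f)).symm)
  zero := Func.mk (fun _ _ _ => 0) (fun f _ _ => (map_zero (Mon0.fn f)).symm)
  mul_assoc φ ψ χ := Func.ext' fun _ _ _ => mul_assoc _ _ _
  mul_comm φ ψ := Func.ext' fun _ _ _ => mul_comm _ _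
  one_mul φ := Func.ext' fun _ _ _ => one_mul _
  mul_one φ := Func.ext' fun _ _ _ => mul_one _
  zero_mul φ := Func.ext' fun _ _ _ => zero_mul _
  mul_zero φ := Func.ext' fun _ _ _ => mul_zero _

/-- Restriction of functions. -/
def Func.res {U W : Subfunctor X} (h : W ≤ U) : Func U →*₀ Func W where
  toFun φ := Subfunctor.homOfLe h ≫ φ
  map_zero' := rfl
  map_one' := rfl
  map_mul' _ _ := rfl

/-- Basic open neighbourhoods of `x`: finite intersections of open subfunctors that contain `x`. -/
def IsNhd (x : Point X) (U : Subfunctor X) : Prop :=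
  ∃ s : Set (Subfunctor X), s.Finite ∧ (∀ W ∈ s, IsOpenSub W ∧ x ∈ W.obj (op (op F1))) ∧ U = sInf s

theorem IsNhd.top (x : Point X) : IsNhd x ⊤ :=
  ⟨∅, Set.finite_empty, fun _ h => h.elim, sInf_empty.symm⟩

theorem IsNhd.inf {x : Point X} {U W : Subfunctor X} (hU : IsNhd x U) (hW : IsNhd x W) :
    IsNhd x (U ⊓ W) := by
  obtain ⟨s, hs, hs', rfl⟩ := hU
  obtain ⟨t, ht, ht', rfl⟩ := hW
  exact ⟨s ∪ t, hs.union ht, fun V hV => hV.elim (hs' V) (ht' V), sInf_union.symm⟩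

/-- Functions defined on some basic open neighbourhood of `x`. -/
structure LocalFunc (x : Point X) : Type (u + 1) where
  dom : Subfunctor X
  isNhd : IsNhd x dom
  func : Func dom

/-- Two local functions have the same germ if they agree on some neighbourhood. -/
def germSetoid (x : Point X) : Setoid (LocalFunc x) where
  r φ ψ := ∃ (W : Subfunctor X) (_ : IsNhd x W) (h : W ≤ φ.dom) (h' : W ≤ ψ.dom),
    Func.res h φ.func = Func.res h' ψ.func
  iseqv :=
    { refl := fun φ => ⟨φ.dom, φ.isNhd, le_rfl, le_rfl, rfl⟩
      symm := fun ⟨W, hW, h, h', e⟩ => ⟨W, hW, h', h, e.symm⟩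
      trans := fun ⟨W, hW, h, h', e⟩ ⟨W', hW', k, k', e'⟩ =>
        ⟨W ⊓ W', hW.inf hW', inf_le_left.trans h, inf_le_right.trans k',
          (congrArg (Func.res inf_le_left) e).trans (congrArg (Func.res inf_le_right) e')⟩ }

/-- The stalk at `x` of the structure sheaf: germs at `x` of functions. -/
def Stalk (x : Point X) : Type (u + 1) := Quotient (germSetoid x)

/-- The germ of a function on a neighbourhood. -/
def germ (x : Point X) {U : Subfunctor X} (hU : IsNhd x U) (φ : Func U) : Stalk x :=
  Quotient.mk (germSetoid x) ⟨U, hU, φ⟩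

theorem germ_res {x : Point X} {U W : Subfunctor X} (hU : IsNhd x U) (hW : IsNhd x W) (h : W ≤ U)
    (φ : Func U) : germ x hW (Func.res h φ) = germ x hU φ :=
  Quotient.sound ⟨W, hW, le_rfl, h, rfl⟩

/-- Multiplication of germs. -/
def Stalk.mul {x : Point X} : Stalk x → Stalk x → Stalk x :=
  Quotient.map₂
    (fun φ ψ => ⟨φ.dom ⊓ ψ.dom, φ.isNhd.inf ψ.isNhd,
      Func.res inf_le_left φ.func * Func.res inf_le_right ψ.func⟩)
    (fun _ _ ⟨W, hW, h, h₁, e⟩ _ _ ⟨W', hW', k, k₁, e'⟩ =>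
      ⟨W ⊓ W', hW.inf hW', inf_le_inf h k, inf_le_inf h₁ k₁, by
        rw [map_mul, map_mul]
        exact congrArg₂ (· * ·) (congrArg (Func.res inf_le_left) e)
          (congrArg (Func.res inf_le_right) e')⟩)

instance (x : Point X) : CommMonoidWithZero (Stalk x) where
  mul := Stalk.mul
  one := germ x (IsNhd.top x) 1
  zero := germ x (IsNhd.top x) 0
  mul_assoc a b c := by
    induction a, b, c using Quotient.inductionOn₃ with
    | _ a b c =>
      refine Quotient.sound ⟨a.dom ⊓ b.dom ⊓ c.dom, (a.isNhd.inf b.isNhd).inf c.isNhd, le_rfl,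
        (inf_assoc _ _ _).le, ?_⟩
      exact Func.ext' fun _ _ _ => mul_assoc _ _ _
  mul_comm a b := by
    induction a, b using Quotient.inductionOn₂ with
    | _ a b =>
      refine Quotient.sound ⟨a.dom ⊓ b.dom, a.isNhd.inf b.isNhd, le_rfl, (inf_comm _ _).le, ?_⟩
      exact Func.ext' fun _ _ _ => mul_comm _ _
  one_mul a := by
    induction a using Quotient.inductionOn with
    | _ a =>
      refine Quotient.sound ⟨a.dom, a.isNhd, le_inf le_top le_rfl, le_rfl, ?_⟩
      exact Func.ext' fun _ _ _ => one_mul _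
  mul_one a := by
    induction a using Quotient.inductionOn with
    | _ a =>
      refine Quotient.sound ⟨a.dom, a.isNhd, le_inf le_rfl le_top, le_rfl, ?_⟩
      exact Func.ext' fun _ _ _ => mul_one _
  zero_mul a := by
    induction a using Quotient.inductionOn with
    | _ a =>
      refine Quotient.sound ⟨a.dom, a.isNhd, le_inf le_top le_rfl, le_top, ?_⟩
      exact Func.ext' fun _ _ _ => zero_mul _
  mul_zero a := by
    induction a using Quotient.inductionOn with
    | _ a =>
      refine Quotient.sound ⟨a.dom, a.isNhd, le_inf le_rfl le_top, le_top, ?_⟩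
      exact Func.ext' fun _ _ _ => mul_zero _

/-- The set `Hom(O_x^×, G)`, where `G` carries an absorbing element (which is never attained, because
the elements of `O_x^×` are invertible). -/
abbrev StalkHom (x : Point X) (G : Type u) [CommGroup G] : Type (u + 1) :=
  (Stalk x)ˣ →* adjZero G

/-- `f` is the homomorphism `O_x^× → G` given by the point `s : Spec (G ∪ {0}) ⟶ X`: the point `s`
lies over `x`, and `f` evaluates invertible germs at `s`. -/
def IsEvaluationAt (x : Point X) {G : Type u} [CommGroup G] (s : Pts X (adjZero G))
    (f : StalkHom x G) : Prop :=
  ptsMap X (toF1 G) s = x ∧ ∀ v : (Stalk x)ˣ,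
    ∃ (U : Subfunctor X) (hU : IsNhd x U) (hs : s ∈ U.obj (op (op (adjZero G)))) (φ : Func U),
      germ x hU φ = v ∧ φ.val s hs = f v

end Stalk

namespace F1SchemeWithRelations

variable (Z : F1SchemeWithRelations.{u})

/-- The map from `(G ∪ {0}, (G ∪ {0}) ⊗ ℤ)`-points of the scheme over blueprints to
`G ∪ {0}`-points of the monoidal scheme. -/
def pointUnder (G : Type u) [CommGroup G] :
    Pts Z.blue (NBlue.sigma (adjZero G)) → Pts Z.under (adjZero G) :=
  fun t => Z.unit.app (op (op (NBlue.sigma (adjZero G)))) t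

/-- The subset of `Hom(O_x^×, G)` of the homomorphisms that satisfy the relations of the blueprint
structure. A homomorphism `f : O_x^× → G` is the same as a `G ∪ {0}`-point of the monoidal scheme
over `x`: on a chart `Spec (A, A ⊗ ℤ → R)` around `x`, with `x` a prime ideal `p` of `A`, the point
is the map `A → G ∪ {0}` which is `0` on `p` and `f` off `p`. The relations hold for `f` if
`A ⊗ ℤ → (G ∪ {0}) ⊗ ℤ` factors through `R`; that is, if the point lifts to a
`(G ∪ {0}, (G ∪ {0}) ⊗ ℤ)`-point of the scheme over blueprints. -/
def blueHom (x : Point Z.under) (G : Type u) [CommGroup G] : Set (StalkHom x G) :=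
  { f | ∃ t : Pts Z.blue (NBlue.sigma (adjZero G)), IsEvaluationAt x (Z.pointUnder G t) f }

/-- The underlying scheme over blueprints is noetherian. -/
def IsNoetherian : Prop := IsNoetherianMonoidalScheme Z.under

/-- The underlying (noetherian) scheme over blueprints is torsion-free: for every point, the number
of compatible homomorphisms to a finite abelian group is polynomial in the order of the group. -/
def IsTorsionFree : Prop :=
  ∀ x : Point Z.under, ∃ p : Polynomial ℚ, ∀ (G : Type u) [CommGroup G] [Finite G],
    (Z.blueHom x G).Finite ∧ ((Z.blueHom x G).ncard : ℚ) = p.eval (Nat.card G : ℚ)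

/-- The cyclic group of order `n`; with an absorbing element adjoined, this is `𝔽_{1ⁿ}`. -/
abbrev Cyc (n : ℕ) : Type u := ULift.{u} (Multiplicative (ZMod n))

/-- The number `P(n)` of all homomorphisms `O_x^× → 𝔽_{1ⁿ}`, summed over the points. -/
def P (n : ℕ) : ℕ∞ := ∑' x : Point Z.under, ENat.card (StalkHom x (Cyc.{u} n))

/-- The number `Q(n)` of compatible homomorphisms `O_x^× → 𝔽_{1ⁿ}`, summed over the points. -/
def Q (n : ℕ) : ℕ∞ := ∑' x : Point Z.under, (Z.blueHom x (Cyc.{u} n)).encard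

end F1SchemeWithRelations

end F1Geom

end

/-!
The statement reduces to the finiteness of the set of points of the monoidal scheme `X` underlying
the given scheme. Indeed, `blueHom x G` is a subset of `Hom(O_x^×, G)`, which gives `Q ≤ P` term by
term; and by torsion-freeness `#(blueHom x (ℤ/n))` is a polynomial in `n` for each point `x`, so that
`Q` is polynomial as soon as it is a finite sum.

Points of `X` are elements of `X(𝔽₁)`, and their finiteness has a local and a global part.

* Local: a noetherian monoid `A` has finitely many homomorphisms to `𝔽₁`, that is, finitely many
  prime ideals (`finite_hom_F1_of_isNoetherianMonoid`). By noetherian induction on a congruence `θ`,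
  there are finitely many homomorphisms that factor through `A / θ`. If some `a` is congruent to
  neither `0` nor `1`, such a homomorphism factors through `A / (θ, a ∼ 0)` or `A / (θ, a ∼ 1)`;
  otherwise there is at most one.

* Global: every point of `X` lies in a chart of an affine cover (`exists_chart_of_point`). The cover is
  only surjective after sheafification, so this says that `Spec 𝔽₁` has no nontrivial Zariski covering
  sieves. More generally, every `g : A → 𝔽₁` belongs to every covering sieve of `Spec A`
  (`mem_of_mem_zariski`). For a generating cover this is where conservativity enters: if `g` does not
  factor through `f : A → B`, then base change along `f` kills the `A`-module `𝔽₁`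
  (`exists_factorization_of_map_ne_zero`), and a jointly conservative family cannot kill a nonzero
  module.
-/

namespace F1Geom

/-! ### Homomorphisms from noetherian monoids to `𝔽₁` -/

theorem F1.eq_zero_or_one (z : F1.{u}) : z = 0 ∨ z = 1 := by
  induction z using WithZero.recZeroCoe with
  | zero => exact Or.inl rfl
  | coe a => exact Or.inr rfl

theorem F1.zero_ne_one : (0 : F1.{u}) ≠ 1 :=
  WithZero.zero_ne_coe

/-- A noetherian monoid has finitely many homomorphisms to `𝔽₁`, i.e. finitely many prime ideals. -/
theorem finite_hom_F1_of_isNoetherianMonoid {A : Mon0.{u}} (hA : IsNoetherianMonoid A) :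
    Finite (A ⟶ F1.{u}) := by
  have : WellFoundedGT (Con A) := hA
  let S : Con A → Set (A →*₀ F1.{u}) := fun θ => {χ | θ ≤ Con.ker χ}
  suffices h : ∀ θ, (S θ).Finite by
    have hbot : S ⊥ = Set.univ := Set.eq_univ_of_forall fun χ => (bot_le : ⊥ ≤ Con.ker χ)
    exact Set.finite_univ_iff.1 (hbot ▸ h ⊥)
  intro θ
  induction θ using WellFoundedGT.induction with
  | _ θ ih =>
  by_cases h : ∃ a : A, ¬ θ a 0 ∧ ¬ θ a 1
  · obtain ⟨a, h0, h1⟩ := h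
    let adjoin : A → Con A := fun b => conGen fun x y => x = a ∧ y = b
    have rel_adjoin (b : A) : adjoin b a b := ConGen.Rel.of _ _ ⟨rfl, rfl⟩
    have lt (b : A) (hb : ¬ θ a b) : θ < θ ⊔ adjoin b :=
      lt_of_le_not_ge le_sup_left fun hle => hb (hle (le_sup_right (a := θ) (rel_adjoin b)))
    refine ((ih _ (lt 0 h0)).union (ih _ (lt 1 h1))).subset fun χ hχ => ?_
    rcases F1.eq_zero_or_one (χ a) with h | h
    · refine Or.inl (sup_le hχ (Con.conGen_le.2 ?_))
      rintro x y ⟨rfl, rfl⟩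
      exact h.trans χ.map_zero.symm
    · refine Or.inr (sup_le hχ (Con.conGen_le.2 ?_))
      rintro x y ⟨rfl, rfl⟩
      exact h.trans χ.map_one.symm
  · push Not at h
    refine Set.Subsingleton.finite fun χ hχ ψ hψ => MonoidWithZeroHom.ext fun a => ?_
    by_cases h0 : θ a 0
    · exact ((hχ h0).trans χ.map_zero).trans ((hψ h0).trans ψ.map_zero).symm
    · exact ((hχ (h a h0)).trans χ.map_one).trans ((hψ (h a h0)).trans ψ.map_one).symm

/-! ### Zariski covering sieves and `𝔽₁`-points -/

/-- Let `g : A → 𝔽₁` and let `K` be a module over `B`. A nonzero `A`-equivariant map from `𝔽₁` to `K`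
forces `g` to factor through `f : A → B`: if `n ≠ 0` is the image of `1`, the elements of `B` that
divide an element of the stabilizer of `n` form the complement of a prime ideal, which induces the
factorization. -/
theorem exists_factorization_of_map_ne_zero {A B : Mon0.{u}} (f : A ⟶ B) (g : A ⟶ F1.{u})
    (K : PtMod B) (n : K.carrier) (hn : n ≠ 0)
    (h1 : ∀ a : A, Mon0.fn g a = 1 → Mon0.fn f a • n = n)
    (h0 : ∀ a : A, Mon0.fn g a = 0 → Mon0.fn f a • n = 0) : ∃ k : B ⟶ F1.{u}, f ≫ k = g := by
  classical
  let F : B → Prop := fun b => ∃ b' : B, (b' * b) • n = n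
  have F_mul (b c : B) : F (b * c) ↔ F b ∧ F c := by
    constructor
    · rintro ⟨d, hd⟩
      exact ⟨⟨d * c, by
        have : d * c * b = d * (b * c) := by ac_rfl
        rw [this, hd]⟩,
        ⟨d * b, by rw [mul_assoc]; exact hd⟩⟩
    · rintro ⟨⟨b', hb⟩, ⟨c', hc⟩⟩
      refine ⟨b' * c', ?_⟩
      have : b' * c' * (b * c) = (b' * b) * (c' * c) := by ac_rfl
      rw [this, mul_smul, hc, hb]
  let k : B →*₀ F1.{u} :=
    { toFun := fun b => if F b then 1 else 0
      map_zero' := if_neg fun ⟨b', hb⟩ => hn (by rw [← hb, mul_zero, zero_smul])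
      map_one' := if_pos ⟨1, by rw [mul_one, one_smul]⟩
      map_mul' := fun b c => by
        by_cases hb : F b <;> by_cases hc : F c <;> simp [F_mul, hb, hc] }
  refine ⟨k, MonoidWithZeroHom.ext fun a => ?_⟩
  change (if F (Mon0.fn f a) then (1 : F1.{u}) else 0) = Mon0.fn g a
  rcases F1.eq_zero_or_one (Mon0.fn g a) with h | h
  · rw [h]
    exact if_neg fun ⟨b', hb⟩ => hn (by rw [← hb, mul_smul, h0 a h, smul_zero])
  · rw [h]
    exact if_pos ⟨1, by rw [one_mul, h1 a h]⟩

/-- The monoid `𝔽₁` as a module over itself. -/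
def F1.self : PtMod F1.{u} := ⟨F1.{u}⟩

/-- The zero module. -/
def PtMod.trivial (A : Mon0.{u}) : PtMod A := ⟨PUnit.{u + 1}⟩

/-- The zero map to the zero module. -/
def PtMod.toTrivial {A : Mon0.{u}} (N : PtMod A) : N ⟶ PtMod.trivial A :=
  (⟨fun _ => PUnit.unit, fun _ _ => rfl⟩ : N.carrier →[A] PUnit.{u + 1})

/-- If `g : A → 𝔽₁` does not factor through `f : A → B`, the base change of the `A`-module `𝔽₁` along
`f` is zero. -/
theorem isIso_map_toTrivial {A B : Mon0.{u}} (f : A ⟶ B) (g : A ⟶ F1.{u})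
    (hfg : ¬ ∃ k : B ⟶ F1.{u}, f ≫ k = g) (L : PtMod A ⥤ PtMod B) (adj : L ⊣ PtMod.res f) :
    IsIso (L.map (PtMod.toTrivial ((PtMod.res g).obj F1.self))) := by
  have fn_zero {A : Mon0.{u}} {N N' : PtMod A} (h : N ⟶ N') : PtMod.fn h 0 = 0 := by
    have := map_smul (PtMod.fn h) (0 : A) 0
    rwa [zero_smul, zero_smul] at this
  have smul_map_one (K : PtMod B) (h : (PtMod.res g).obj F1.self ⟶ (PtMod.res f).obj K) (a : A)
      (n : K.carrier) (hn : PtMod.fn h (1 : F1.{u}) = n) :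
      Mon0.fn f a • n = PtMod.fn h (Mon0.fn g a) := by
    subst hn
    exact (map_smul (PtMod.fn h) a _).symm.trans (congrArg (PtMod.fn h) (mul_one (Mon0.fn g a)))
  have zero_on_F1 (K : PtMod B) (h : (PtMod.res g).obj F1.self ⟶ (PtMod.res f).obj K)
      (z : F1.{u}) : PtMod.fn h z = (0 : K.carrier) := by
    rcases F1.eq_zero_or_one z with rfl | rfl
    · exact fn_zero h
    · by_contra hn
      refine hfg (exists_factorization_of_map_ne_zero f g K _ hn
        (fun a ha => (smul_map_one K h a _ rfl).trans (congrArg (PtMod.fn h) ha))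
        fun a ha => (smul_map_one K h a _ rfl).trans
          ((congrArg (PtMod.fn h) ha).trans (fn_zero h)))
  have sub_F1 (K : PtMod B) : Subsingleton ((PtMod.res g).obj F1.self ⟶ (PtMod.res f).obj K) :=
    ⟨fun h h' => MulActionHom.ext fun z => (zero_on_F1 K h z).trans (zero_on_F1 K h' z).symm⟩
  have sub_trivial (K : PtMod B) : Subsingleton (PtMod.trivial A ⟶ (PtMod.res f).obj K) :=
    ⟨fun h h' => MulActionHom.ext fun _ => (fn_zero h).trans (fn_zero h').symm⟩
  have sub (N : PtMod A) (hN : ∀ K, Subsingleton (N ⟶ (PtMod.res f).obj K)) (K : PtMod B) :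
      Subsingleton (L.obj N ⟶ K) :=
    have := hN K
    (adj.homEquiv N K).subsingleton
  have := sub _ sub_F1
  have := sub _ sub_trivial
  -- The zero map `0 ⟶ 𝔽₁` induces the inverse.
  let back : PtMod.trivial A ⟶ (PtMod.res g).obj F1.self :=
    (⟨fun _ => (0 : F1.{u}), fun a _ => (mul_zero (Mon0.fn g a)).symm⟩ :
      PUnit.{u + 1} →[A] ((PtMod.res g).obj F1.self).carrier)
  exact ⟨L.map back, Subsingleton.elim _ _, Subsingleton.elim _ _⟩

/-- Every `𝔽₁`-point of an affine scheme belongs to every Zariski covering sieve. -/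
theorem mem_of_mem_zariski {X : Mon0.{u}ᵒᵖ} {S : Sieve X} (hS : S ∈ zariski Mon0.{u} X)
    (g : X.unop ⟶ F1.{u}) : S (Quiver.Hom.op g : op F1.{u} ⟶ X) := by
  induction (hS : (zariskiCovers Mon0.{u}).Saturate X S) with
  | of X S hS =>
    obtain ⟨-, T, -, hTS, hT⟩ := hS
    by_contra hg
    have iso : IsIso (PtMod.toTrivial ((PtMod.res g).obj F1.self)) := by
      refine hT _ fun f hf L adj => isIso_map_toTrivial f.2.unop g ?_ L adj
      rintro ⟨k, hk⟩
      exact hg ⟨f.1, k.op, f.2, hTS f hf, congrArg Quiver.Hom.op hk⟩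
    -- An isomorphism from `𝔽₁` to the zero module would identify `0` and `1`.
    have inj := congrArg (fun h => PtMod.fn h)
      (IsIso.hom_inv_id (PtMod.toTrivial ((PtMod.res g).obj F1.self)))
    have h0 : _ = (0 : F1.{u}) := congrArg (fun h => h (0 : F1.{u})) inj
    have h1 : _ = (1 : F1.{u}) := congrArg (fun h => h (1 : F1.{u})) inj
    exact F1.zero_ne_one (h0.symm.trans h1)
  | top => trivial
  | pullback X S hS Y f ih => exact ih (f.unop ≫ g)
  | transitive X S R hS hR ih ih' =>
    have := ih' (ih g) (𝟙 _)
    exact (Category.id_comp (Quiver.Hom.op g : op F1.{u} ⟶ X)) ▸ this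

/-! ### Points of noetherian monoidal schemes -/

/-- Every point lies in a chart of an affine Zariski cover. -/
theorem exists_chart_of_point {X : PSh Mon0.{u}} {ι : Type u} {A : ι → Mon0.{u}}
    {p : ∀ i, Spec (A i) ⟶ X} (hp : IsAffineZariskiCover p) (x : Point X) :
    ∃ (i : ι) (y : Point (Spec (A i))), (p i).app (op (op F1.{u})) y = x := by
  have hx : x ∈ ((⨆ i, Subfunctor.range (p i)).sheafify (zariski Mon0.{u})).obj
      (op (op F1.{u})) := by
    rw [hp.2]
    trivial
  have hid := mem_of_mem_zariski hx (𝟙 F1.{u})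
  have hmem : x ∈ (⨆ i, Subfunctor.range (p i)).obj (op (op F1.{u})) := by
    have h : X.map (𝟙 (op F1.{u})).op x ∈
      (⨆ i, Subfunctor.range (p i)).obj (op (op F1.{u})) := hid
    rwa [op_id, Functor.map_id_apply] at h
  rw [Subfunctor.iSup_obj, Set.mem_iUnion] at hmem
  exact hmem

theorem IsNoetherianMonoidalScheme.finite_point {X : PSh Mon0.{u}}
    (hX : IsNoetherianMonoidalScheme X) : Finite (Point X) := by
  obtain ⟨-, ι, _, A, p, hA, hp⟩ := hX
  have (i : ι) : Finite (Point (Spec (A i))) :=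
    have := finite_hom_F1_of_isNoetherianMonoid (hA i)
    Finite.of_equiv (A i ⟶ F1.{u}) (opEquiv (op F1.{u}) (op (A i))).symm
  refine Finite.of_surjective
    (fun q : Σ i, Point (Spec (A i)) => (p q.1).app (op (op F1.{u})) q.2) fun x => ?_
  obtain ⟨i, y, h⟩ := exists_chart_of_point hp x
  exact ⟨⟨i, y⟩, h⟩

end F1Geom

theorem mainTheorem10 (Z : F1Geom.F1SchemeWithRelations.{u}) (hN : Z.IsNoetherian)
    (hT : Z.IsTorsionFree) :
    Finite (F1Geom.Point Z.under) ∧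
    (∃ q : Polynomial ℚ, ∀ n : ℕ, 1 ≤ n → ∃ m : ℕ, Z.Q n = m ∧ (m : ℚ) = q.eval (n : ℚ)) ∧
    ∀ n : ℕ, 1 ≤ n → Z.Q n ≤ Z.P n := by
  have hfin : Finite (F1Geom.Point Z.under) :=
    F1Geom.IsNoetherianMonoidalScheme.finite_point hN
  have := Fintype.ofFinite (F1Geom.Point Z.under)
  refine ⟨hfin, ?_, fun n _ => ?_⟩
  · choose p hp using hT
    refine ⟨∑ x, p x, fun n hn => ?_⟩
    have : NeZero n := ⟨by omega⟩
    have card_cyc : Nat.card (F1Geom.F1SchemeWithRelations.Cyc.{u} n) = n := by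
      rw [Nat.card_ulift, Nat.card_congr Multiplicative.toAdd, Nat.card_zmod]
    have : Finite (F1Geom.F1SchemeWithRelations.Cyc.{u} n) :=
      Nat.finite_of_card_ne_zero (card_cyc.trans_ne (NeZero.ne n))
    refine ⟨∑ x, (Z.blueHom x (F1Geom.F1SchemeWithRelations.Cyc.{u} n)).ncard, ?_, ?_⟩
    · rw [F1Geom.F1SchemeWithRelations.Q, tsum_fintype, Nat.cast_sum]
      exact Finset.sum_congr rfl fun x _ => ((hp x _).1.cast_ncard_eq).symm
    · rw [Nat.cast_sum, Polynomial.eval_finsetSum]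
      exact Finset.sum_congr rfl fun x _ => by rw [(hp x _).2, card_cyc]
  · rw [F1Geom.F1SchemeWithRelations.Q, F1Geom.F1SchemeWithRelations.P, tsum_fintype, tsum_fintype]
    refine Finset.sum_le_sum fun x _ => ?_
    rw [← Set.encard_univ]
    exact Set.encard_le_encard (Set.subset_univ _)
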